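/- For real $z>0$ let $\zeta(w,z)$ be the Hurwitz zeta function, that is, the meromorphic continuation to $w\in\mathbb C$ of $\sum_{m\ge 0}(m+z)^{-w}$ ($\mathrm{Re}\,w>1$), and for an integer $k\ge 1$ let $\mathcal G_k(z):=\exp\bigl(\frac{\partial}{\partial w}\zeta(w,z)\big|_{w=1-k}\bigr)$ be the Milnor gamma function of depth $k$. Let $n\ge 1$, $r\ge 1$, $d\ge 0$ be integers, let $s\in\mathbb R$ with $|s|<\frac13$, and put $\xi^{\pm}_n(s):=1+\frac{n-1}{2}\pm s$. Then the function $$H_{\xi_n^+(s),\xi_n^-(s)}(w,w-d)=\sum_{k=0}^{\infty}\frac{1}{(k+\xi_n^+(s))^{w}(k+\xi_n^-(s))^{w-d}}\qquad\Bigl(\mathrm{Re}\,w>\frac{d+1}{2}\Bigr)$$ has a meromorphic continuation in $w$ to $\mathbb C$, which is holomorphic at $w=1-r$, and $$I^d_{n,r}(s):=\exp\Bigl(-\frac{\partial}{\partial w}H_{\xi_n^+(s),\xi_n^-(s)}(w,w-d)\Big|_{w=1-r}\Bigr)$$ satisfies $$I^{d}_{n,r}(s)=\exp\Bigl(\frac{(-1)^{r+d}(r-1)!}{2\,(r+d)_r}H(r,r+d-1)(2s)^{2r+d-1}\Bigr)\prod_{k=r}^{2r+d-1}\mathcal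 G_k\bigl(\xi_n^+(s)\bigr)^{(-1)^{k+d}\binom{r+d-1}{k-r}(2s)^{2r+d-k-1}}\prod_{k=r+d}^{2r+d-1}\mathcal G_k\bigl(\xi_n^-(s)\bigr)^{-\binom{r-1}{2r+d-k-1}(2s)^{2r+d-k-1}},$$ where $(a)_r:=a(a+1)\cdots(a+r-1)$, $H(m,l):=\sum_{j=m}^{l}\frac1j$ (which is $0$ if $m>l$), and $0^0=1$. -/

import Mathlib

/-- `F` is the meromorphic continuation to `ℂ` of the function given for `Re w > σ` by the
convergent series `∑ k, a k w`.  Normal form means that `F` is analytic at every point which is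
not a pole (so there are no removable singularities), and has the value `0` at its poles. -/
def IsMeromorphicContinuation (a : ℕ → ℂ → ℂ) (σ : ℝ) (F : ℂ → ℂ) : Prop :=
  MeromorphicNFOn F Set.univ ∧ ∀ w : ℂ, σ < w.re → HasSum (fun k => a k w) (F w)

/-- A series has at most one meromorphic continuation. -/
theorem IsMeromorphicContinuation.unique {a : ℕ → ℂ → ℂ} {σ : ℝ} {F G : ℂ → ℂ}
    (hF : IsMeromorphicContinuation a σ F) (hG : IsMeromorphicContinuation a σ G) : F = G := by
  have hmF : MeromorphicOn F Set.univ := fun z hz => (hF.1 hz).meromorphicAt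
  have hmG : MeromorphicOn G Set.univ := fun z hz => (hG.1 hz).meromorphicAt
  have hm : MeromorphicOn (F - G) Set.univ := hmF.sub hmG
  have htop : meromorphicOrderAt (F - G) ((σ + 1 : ℝ) : ℂ) = ⊤ := by
    rw [meromorphicOrderAt_eq_top_iff]
    apply Filter.Eventually.filter_mono nhdsWithin_le_nhds
    have ho : IsOpen {w : ℂ | σ < w.re} := isOpen_lt continuous_const Complex.continuous_re
    filter_upwards [ho.mem_nhds (show σ < (((σ + 1 : ℝ) : ℂ)).re by simp)] with w hw
    simp [(hF.2 w hw).unique (hG.2 w hw)]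
  funext z
  have hz : meromorphicOrderAt (F - G) z = ⊤ := by
    by_contra hne
    exact hm.meromorphicOrderAt_ne_top_of_isPreconnected isPreconnected_univ
      (Set.mem_univ z) (Set.mem_univ _) hne htop
  rw [meromorphicOrderAt_eq_top_iff] at hz
  have h1 : F =ᶠ[nhdsWithin z {z}ᶜ] G := by
    filter_upwards [hz] with w hw
    exact sub_eq_zero.mp hw
  exact (((hF.1 (Set.mem_univ z)).eventuallyEq_nhdsNE_iff_eventuallyEq_nhds
    (hG.1 (Set.mem_univ z))).1 h1).eq_of_nhds

/-- The meromorphic continuation to `ℂ` of `∑ k, a k w`, `Re w > σ` (when there is one). -/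
noncomputable def meromorphicContinuation (a : ℕ → ℂ → ℂ) (σ : ℝ) : ℂ → ℂ :=
  Classical.epsilon (IsMeromorphicContinuation a σ)

/-- The Hurwitz zeta function `ζ(w, z)` of a real parameter `z > 0`, continued to `w ≠ 1`.
Mathlib's `hurwitzZeta` is periodic in the parameter and gives the classical function for
parameters in `(0, 1]`; with `N = ⌈z⌉ - 1`, so that `z - N ∈ (0, 1]`, the first `N` terms of the
series with parameter `z - N` are removed. -/
noncomputable def hurwitzZetaPos (z : ℝ) (w : ℂ) : ℂ :=
  HurwitzZeta.hurwitzZeta (z : UnitAddCircle) w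
    - ∑ m ∈ Finset.range (⌈z⌉₊ - 1), 1 / ((m : ℂ) + ((z - ((⌈z⌉₊ - 1 : ℕ) : ℝ) : ℝ) : ℂ)) ^ w

/-- `ζ(w, z) = ∑ (m + z)⁻ʷ` for `Re w > 1`. -/
theorem hasSum_hurwitzZetaPos {z : ℝ} (hz : 0 < z) {w : ℂ} (hw : 1 < w.re) :
    HasSum (fun m : ℕ => 1 / ((m : ℂ) + (z : ℂ)) ^ w) (hurwitzZetaPos z w) := by
  obtain ⟨N, hN⟩ : ∃ N : ℕ, ⌈z⌉₊ - 1 = N := ⟨_, rfl⟩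
  have h1 : 1 ≤ ⌈z⌉₊ := Nat.one_le_iff_ne_zero.2 (Nat.ceil_pos.2 hz).ne'
  have hc : (⌈z⌉₊ : ℝ) = N + 1 := by
    have : ⌈z⌉₊ = N + 1 := by omega
    rw [this]; push_cast; ring
  have hmem : z - (N : ℝ) ∈ Set.Icc (0 : ℝ) 1 := by
    have h2 := Nat.le_ceil z
    have h3 := Nat.ceil_lt_add_one hz.le
    constructor <;> linarith
  have hcoe : ((z - (N : ℝ) : ℝ) : UnitAddCircle) = (z : UnitAddCircle) := by
    have : ((N : ℝ) : UnitAddCircle) = 0 := by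
      rw [AddCircle.coe_eq_zero_iff]
      exact ⟨N, by simp⟩
    rw [AddCircle.coe_sub, this, sub_zero]
  have hs := HurwitzZeta.hasSum_hurwitzZeta_of_one_lt_re hmem hw
  rw [hcoe] at hs
  unfold hurwitzZetaPos
  rw [hN]
  have hs' := (hasSum_nat_add_iff (f := fun n : ℕ => 1 / ((n : ℂ) + ((z - (N : ℝ) : ℝ) : ℂ)) ^ w)
    (g := HurwitzZeta.hurwitzZeta (z : UnitAddCircle) w
    - ∑ m ∈ Finset.range N, 1 / ((m : ℂ) + ((z - (N : ℝ) : ℝ) : ℂ)) ^ w) N).2 (by simpa using hs)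
  convert! hs' using 4
  push_cast
  ring

/-- `ζ(w, z)` is holomorphic in `w` on `ℂ \ {1}`. -/
theorem differentiableAt_hurwitzZetaPos {z : ℝ} (hz : 0 < z) {w : ℂ} (hw : w ≠ 1) :
    DifferentiableAt ℂ (hurwitzZetaPos z) w := by
  have hmem : 0 < z - ((⌈z⌉₊ - 1 : ℕ) : ℝ) := by
    have h1 : 1 ≤ ⌈z⌉₊ := Nat.one_le_iff_ne_zero.2 (Nat.ceil_pos.2 hz).ne'
    have h3 := Nat.ceil_lt_add_one hz.le
    rw [Nat.cast_sub h1]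
    push_cast
    linarith
  unfold hurwitzZetaPos
  refine (HurwitzZeta.differentiableAt_hurwitzZeta _ hw).sub
    (DifferentiableAt.fun_sum fun m _ => ?_)
  have hne : (m : ℂ) + ((z - ((⌈z⌉₊ - 1 : ℕ) : ℝ) : ℝ) : ℂ) ≠ 0 := by
    have : (m : ℝ) + (z - ((⌈z⌉₊ - 1 : ℕ) : ℝ)) ≠ 0 := by positivity
    exact_mod_cast this
  refine (differentiableAt_const _).div (differentiableAt_id.const_cpow (Or.inl hne)) ?_
  exact fun h => hne (Complex.cpow_eq_zero_iff _ _ |>.1 h).1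

/-- Milnor gamma function of depth `r`: `exp (∂/∂w ζ(w, z) at w = 1 - r)`, for real `z > 0`. -/
noncomputable def milnorGamma (r : ℕ) (z : ℝ) : ℂ :=
  Complex.exp (deriv (hurwitzZetaPos z) (1 - (r : ℂ)))

/-- The `k`-th term of the two-variable Hurwitz zeta function
`H_{α₁,α₂}(w₁, w₂) = ∑ 1 / ((k + α₁) ^ w₁ (k + α₂) ^ w₂)`. -/
noncomputable def twoVarHurwitzTerm (α₁ α₂ : ℝ) (w₁ w₂ : ℂ) (k : ℕ) : ℂ :=
  1 / (((k : ℂ) + (α₁ : ℂ)) ^ w₁ * ((k : ℂ) + (α₂ : ℂ)) ^ w₂)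

/-- The meromorphic function `w ↦ H_{α₁,α₂}(w, w - d)`; its series converges for
`Re (2 w - d) > 1`. -/
noncomputable def twoVarHurwitzDiag (α₁ α₂ : ℝ) (d : ℕ) : ℂ → ℂ :=
  meromorphicContinuation (fun k w => twoVarHurwitzTerm α₁ α₂ w (w - (d : ℂ)) k)
    (((d : ℝ) + 1) / 2)

/-- `ξ⁺ₙ(s) = 1 + (n - 1) / 2 + s`. -/
noncomputable def xiPlus (n : ℕ) (s : ℝ) : ℝ := 1 + ((n : ℝ) - 1) / 2 + s

/-- `ξ⁻ₙ(s) = 1 + (n - 1) / 2 - s`. -/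
noncomputable def xiMinus (n : ℕ) (s : ℝ) : ℝ := 1 + ((n : ℝ) - 1) / 2 - s

/-- `Iᵈₙ,ᵣ(s) = exp (- ∂/∂w H_{ξ⁺ₙ(s),ξ⁻ₙ(s)}(w, w - d) at w = 1 - r)`. -/
noncomputable def detFactor (n r d : ℕ) (s : ℝ) : ℂ :=
  Complex.exp (-deriv (twoVarHurwitzDiag (xiPlus n s) (xiMinus n s) d) (1 - (r : ℂ)))

/-- `H(m, n) = ∑_{j = m}^{n} 1 / j`, which is `0` if `m > n`. -/
noncomputable def harmonicBetween (m n : ℕ) : ℝ := ∑ j ∈ Finset.Icc m n, 1 / (j : ℝ)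

/-! Put z = ξ⁺, h = 2s, so that ξ⁻ = z - h, and w = -a + ε with a = r - 1, b = a + d. The series
becomes the case m = 1 of F_m(ε) = ∑ (k+z)^(a-(2-m)ε) (k+z-h)^(b-mε) = ∑ (k+z)^(a+b-2ε)
(1-h/(k+z))^(b-mε). For m = 0 and m = 2 one exponent is a natural number, and the binomial theorem
turns F_m into a finite sum of Hurwitz zeta functions (`regularizedExpansion_zero`,
`regularizedExpansion_two`); their derivatives at 0 are the logarithms of the Milnor gamma factors.

To reach m = 1, expand the second factor: F_m is the sum over j ≤ a+b+1 of choose(b-mε, j) (-h)^j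
ζ(j-a-b+2ε, z), plus a holomorphic remainder. Since m enters only through b - mε, the product rule
makes each regular term contribute an affine function of m to F_m'(0). Only j = a+b+1 meets the pole
of ζ; its coefficient is mε times a polynomial in mε, which cancels the pole and adds a term Rm². So
F_m'(0) = P + Qm + Rm² (`exists_hasDerivAt_regularizedExpansion`), and F_1'(0) = (F_0'(0) +
F_2'(0))/2 - R. The constant R carries the harmonic sum (`hasDerivAt_chooseQuotient`) and yields the
exponential prefactor. -/

open Filter Topology

/-! ### Binomial series with remainder bounds uniform in the exponent -/

/-- Generalized binomial coefficients as falling products. -/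
theorem ringChoose_eq_prod (β : ℂ) (j : ℕ) :
    Ring.choose β j = (∏ i ∈ Finset.range j, (β - i)) / j.factorial := by
  have h : (descPochhammer ℤ j).smeval β = ∏ i ∈ Finset.range j, (β - i) := by
    induction j with
    | zero => simp
    | succ n ih =>
      rw [descPochhammer_succ_right, Polynomial.smeval_mul, ih, Finset.prod_range_succ]
      simp [Polynomial.smeval_natCast]
  rw [Ring.choose_eq_smul, h, smul_eq_mul, div_eq_inv_mul]

theorem differentiable_ringChoose (j : ℕ) : Differentiable ℂ fun β : ℂ => Ring.choose β j := by
  simp_rw [ringChoose_eq_prod]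
  fun_prop

/-- Each factor satisfies |β - i| ≤ B + i, with equality at β = -B, so one majorant serves the whole
disc of exponents. -/
theorem norm_ringChoose_le {β : ℂ} {B : ℝ} (hβ : ‖β‖ ≤ B) (j : ℕ) :
    ‖Ring.choose β j‖ ≤ ‖Ring.choose (-(B : ℂ)) j‖ := by
  have hB : 0 ≤ B := (norm_nonneg _).trans hβ
  rw [ringChoose_eq_prod, ringChoose_eq_prod, norm_div, norm_div, norm_prod, norm_prod]
  gcongr with i _
  have h1 : ‖-(B : ℂ) - i‖ = B + i := by
    rw [← neg_add', norm_neg]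
    have : ((B : ℂ) + i) = ((B + i : ℝ) : ℂ) := by push_cast; rfl
    rw [this, Complex.norm_real, Real.norm_of_nonneg (by positivity)]
  rw [h1]
  refine (norm_sub_le _ _).trans ?_
  simpa using hβ

theorem summable_norm_ringChoose_mul_pow (β : ℂ) {ρ : ℝ} (h0 : 0 ≤ ρ) (h1 : ρ < 1) :
    Summable fun j : ℕ => ‖Ring.choose β j‖ * ρ ^ j := by
  lift ρ to NNReal using h0
  have := (binomialSeries ℂ β).summable_norm_mul_pow (r := ρ)
    (lt_of_lt_of_le (by exact_mod_cast h1) binomialSeries_radius_ge_one)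
  simpa [binomialSeries, FormalMultilinearSeries.ofScalars_norm] using this

theorem hasSum_ringChoose_mul_pow (β : ℂ) {x : ℂ} (hx : ‖x‖ < 1) :
    HasSum (fun j : ℕ => Ring.choose β j * x ^ j) ((1 + x) ^ β) := by
  have := (Complex.one_add_cpow_hasFPowerSeriesOnBall_zero (a := β)).hasSum (y := x)
    (by rw [← ENNReal.ofReal_one, Metric.eball_ofReal]; simpa using hx)
  simpa [binomialSeries, mul_comm] using this

/-- The remainder of the binomial series of `(1 - u) ^ β` after `J` terms. -/
noncomputable def binomialRemainder (J : ℕ) (β u : ℂ) : ℂ :=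
  (1 - u) ^ β - ∑ j ∈ Finset.range J, Ring.choose β j * (-u) ^ j

/-- The tail of the majorant series at radius ρ, divided by ρ ^ J, serves as `K`. With u = h/(k+z)
this gives decay of order (k+z)^(-J). -/
theorem exists_norm_binomialRemainder_le (J : ℕ) (B : ℝ) {ρ : ℝ} (h0 : 0 < ρ) (h1 : ρ < 1) :
    ∃ K : ℝ, 0 ≤ K ∧ ∀ β u : ℂ, ‖β‖ ≤ B → ‖u‖ ≤ ρ → ‖binomialRemainder J β u‖ ≤ K * ‖u‖ ^ J := by
  have hs := summable_norm_ringChoose_mul_pow (-(B : ℂ)) h0.le h1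
  have hs' := (summable_nat_add_iff J).2 hs
  refine ⟨(∑' j, ‖Ring.choose (-(B : ℂ)) (j + J)‖ * ρ ^ (j + J)) / ρ ^ J, by positivity,
    fun β u hβ hu => ?_⟩
  have hsum := hasSum_ringChoose_mul_pow β (x := -u) (by rw [norm_neg]; linarith)
  have hsum' := (hasSum_nat_add_iff' J).2 hsum
  have hb : ∀ j : ℕ, ‖Ring.choose β (j + J) * (-u) ^ (j + J)‖ ≤
      ‖u‖ ^ J * ((‖Ring.choose (-(B : ℂ)) (j + J)‖ * ρ ^ (j + J)) / ρ ^ J) := by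
    intro j
    rw [norm_mul, norm_pow, norm_neg, pow_add, pow_add, ← mul_assoc, ← mul_assoc,
      mul_div_cancel_right₀ _ (by positivity), mul_comm (‖u‖ ^ J)]
    gcongr
    exact norm_ringChoose_le hβ _
  rw [binomialRemainder, sub_eq_add_neg 1 u, ← hsum'.tsum_eq, mul_comm, ← tsum_div_const,
    ← tsum_mul_left]
  exact tsum_of_norm_bounded ((hs'.div_const _).mul_left _).hasSum hb

theorem binomialRemainder_succ (J : ℕ) (β u : ℂ) :
    binomialRemainder J β u =
      Ring.choose β J * (-u) ^ J + binomialRemainder (J + 1) β u := by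
  simp only [binomialRemainder, Finset.sum_range_succ]
  ring

theorem binomialRemainder_natCast {J b : ℕ} (h : b < J) (u : ℂ) :
    binomialRemainder J (b : ℂ) u = 0 := by
  rw [binomialRemainder, Complex.cpow_natCast, sub_eq_zero, sub_eq_neg_add, add_pow]
  refine Finset.sum_subset_zero_on_sdiff (by simpa using h) ?_ ?_
  · intro j hj
    have : b < j := by simp at hj; omega
    simp [Ring.choose_natCast, Nat.choose_eq_zero_of_lt this]
  · intro j _
    simp [Ring.choose_natCast, mul_comm]

/-! ### Sums over k of binomial remainders -/

/-- The real number `k + z`, cast to `ℂ`, for `z > 0`. -/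
theorem natCast_add_ofReal (z : ℝ) (k : ℕ) : (k : ℂ) + (z : ℂ) = ((k + z : ℝ) : ℂ) := by
  push_cast; rfl

theorem natCast_add_ofReal_ne_zero {z : ℝ} (hz : 0 < z) (k : ℕ) : (k : ℂ) + (z : ℂ) ≠ 0 := by
  rw [natCast_add_ofReal]
  have : (k + z : ℝ) ≠ 0 := by positivity
  exact_mod_cast this

theorem summable_natCast_add_rpow {z : ℝ} (hz : 0 < z) {p : ℝ} (hp : p < -1) :
    Summable fun k : ℕ => ((k : ℝ) + z) ^ p := by
  have := (Real.summable_one_div_nat_add_rpow z (-p)).2 (by linarith)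
  refine this.congr fun k => ?_
  rw [abs_of_pos (by positivity), Real.rpow_neg (by positivity), one_div, inv_inv]

/-- `(k + z) ^ α (1 - h / (k + z)) ^ β` with the first `J` terms of its binomial expansion
removed. -/
noncomputable def powerRemainder (z h : ℝ) (J : ℕ) (α β : ℂ) (k : ℕ) : ℂ :=
  ((k : ℂ) + z) ^ α * binomialRemainder J β (h / ((k : ℂ) + z))

theorem exists_summable_bound_powerRemainder {z h : ℝ} (hz : 0 < z) (hh : |h| < z) (J : ℕ)
    (a₁ a₂ B : ℝ) (h12 : a₁ ≤ a₂) (ha : a₂ < J - 1) :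
    ∃ u : ℕ → ℝ, Summable u ∧ ∀ (k : ℕ) (α β : ℂ), a₁ ≤ α.re → α.re ≤ a₂ → ‖β‖ ≤ B →
      ‖powerRemainder z h J α β k‖ ≤ u k := by
  obtain ⟨ρ, hρ1, hρ2⟩ := exists_between ((div_lt_one hz).2 hh)
  have hρ0 : 0 < ρ := lt_of_le_of_lt (by positivity) hρ1
  obtain ⟨K, hK, hKb⟩ := exists_norm_binomialRemainder_le J B hρ0 hρ2
  refine ⟨fun k => K * |h| ^ J * (((k : ℝ) + z) ^ (a₂ - J) + ((k : ℝ) + z) ^ (a₁ - J)),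
    ((summable_natCast_add_rpow hz (by linarith)).add
      (summable_natCast_add_rpow hz (by linarith))).mul_left _, fun k α β h1 h2 hβ => ?_⟩
  have hx : (0 : ℝ) < k + z := by positivity
  have hu : ‖(h : ℂ) / ((k : ℂ) + z)‖ = |h| / (k + z) := by
    rw [natCast_add_ofReal, norm_div, Complex.norm_real, Complex.norm_real, Real.norm_eq_abs,
      Real.norm_of_nonneg hx.le]
  have hle : ‖(h : ℂ) / ((k : ℂ) + z)‖ ≤ ρ := by
    rw [hu]
    refine le_trans ?_ hρ1.le
    gcongr
    linarith [(Nat.cast_nonneg k : (0 : ℝ) ≤ k)]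
  have hb := hKb β _ hβ hle
  rw [powerRemainder, norm_mul]
  have hn : ‖((k : ℂ) + z) ^ α‖ = ((k : ℝ) + z) ^ α.re := by
    rw [natCast_add_ofReal, Complex.norm_cpow_eq_rpow_re_of_pos hx]
  rw [hn]
  rw [hu] at hb
  -- The base k + z may be below 1 when k = 0, so either end of the strip can dominate; the sum of
  -- both powers covers the two cases.
  have hpow : ((k : ℝ) + z) ^ (α.re - J) ≤
      ((k : ℝ) + z) ^ (a₂ - J) + ((k : ℝ) + z) ^ (a₁ - J) := by
    rcases le_total 1 ((k : ℝ) + z) with h | h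
    · have := Real.rpow_le_rpow_of_exponent_le h (show α.re - J ≤ a₂ - J by linarith)
      have h' : 0 ≤ ((k : ℝ) + z) ^ (a₁ - J) := by positivity
      linarith
    · have := Real.rpow_le_rpow_of_exponent_ge hx h (show a₁ - J ≤ α.re - J by linarith)
      have h' : 0 ≤ ((k : ℝ) + z) ^ (a₂ - J) := by positivity
      linarith
  calc ((k : ℝ) + z) ^ α.re * ‖binomialRemainder J β (h / ((k : ℂ) + z))‖
      ≤ ((k : ℝ) + z) ^ α.re * (K * (|h| / (k + z)) ^ J) := by gcongr
    _ = K * |h| ^ J * ((k : ℝ) + z) ^ (α.re - J) := by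
        rw [Real.rpow_sub hx, Real.rpow_natCast, div_pow]
        ring
    _ ≤ _ := mul_le_mul_of_nonneg_left hpow (by positivity)

theorem summable_powerRemainder {z h : ℝ} (hz : 0 < z) (hh : |h| < z) {J : ℕ} {α : ℂ} (β : ℂ)
    (hα : α.re < J - 1) : Summable (powerRemainder z h J α β) := by
  obtain ⟨u, hu, hb⟩ := exists_summable_bound_powerRemainder hz hh J α.re α.re ‖β‖ le_rfl hα
  exact Summable.of_norm_bounded hu fun k => hb k α β le_rfl le_rfl le_rfl

theorem one_sub_div_mem_slitPlane {z h : ℝ} (hz : 0 < z) (hh : |h| < z) (k : ℕ) :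
    1 - (h : ℂ) / ((k : ℂ) + z) ∈ Complex.slitPlane := by
  have hx : (0 : ℝ) < k + z := by positivity
  have : 1 - (h : ℂ) / ((k : ℂ) + z) = ((1 - h / (k + z) : ℝ) : ℂ) := by push_cast; rfl
  rw [this, Complex.ofReal_mem_slitPlane, sub_pos, div_lt_one hx]
  linarith [le_abs_self h, (Nat.cast_nonneg k : (0 : ℝ) ≤ k)]

theorem differentiable_binomialRemainder {J : ℕ} {u : ℂ} (hu : 1 - u ≠ 0) :
    Differentiable ℂ fun β => binomialRemainder J β u := by
  unfold binomialRemainder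
  refine (differentiable_id.const_cpow (Or.inl hu)).sub (Differentiable.fun_sum fun j _ => ?_)
  exact (differentiable_ringChoose j).mul_const _

theorem differentiable_powerRemainder {z h : ℝ} (hz : 0 < z) (hh : |h| < z) {J : ℕ} {α β : ℂ → ℂ}
    (hα : Differentiable ℂ α) (hβ : Differentiable ℂ β) (k : ℕ) :
    Differentiable ℂ fun w => powerRemainder z h J (α w) (β w) k := by
  unfold powerRemainder
  exact (hα.const_cpow (Or.inl (natCast_add_ofReal_ne_zero hz k))).mul
    ((differentiable_binomialRemainder
      (Complex.slitPlane_ne_zero (one_sub_div_mem_slitPlane hz hh k))).comp hβ)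

/-- Weierstrass: the bound is uniform near w. Termwise differentiation is recorded because the
dependence on m is later read off term by term. -/
theorem tsum_powerRemainder_aux {z h : ℝ} (hz : 0 < z) (hh : |h| < z) {J : ℕ} {α β : ℂ → ℂ}
    (hα : Differentiable ℂ α) (hβ : Differentiable ℂ β) {w : ℂ} (hw : (α w).re < J - 1) :
    AnalyticAt ℂ (fun w => ∑' k, powerRemainder z h J (α w) (β w) k) w ∧
    HasSum (fun k => deriv (fun w => powerRemainder z h J (α w) (β w) k) w)
      (deriv (fun w => ∑' k, powerRemainder z h J (α w) (β w) k) w) := by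
  obtain ⟨a₂, h1, h2⟩ := exists_between hw
  obtain ⟨u, hu, hb⟩ := exists_summable_bound_powerRemainder hz hh J ((α w).re - 1) a₂
    (‖β w‖ + 1) (by linarith) h2
  have hcα : Continuous fun w => (α w).re := Complex.continuous_re.comp hα.continuous
  have hcβ : Continuous fun w => ‖β w‖ := hβ.continuous.norm
  let U : Set ℂ := {v | (α w).re - 1 < (α v).re} ∩ {v | (α v).re < a₂} ∩ {v | ‖β v‖ < ‖β w‖ + 1}
  have hU : IsOpen U := ((isOpen_lt continuous_const hcα).inter
    (isOpen_lt hcα continuous_const)).inter (isOpen_lt hcβ continuous_const)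
  have hwU : w ∈ U := ⟨⟨by simp, h1⟩, by simp⟩
  have hd : ∀ k, DifferentiableOn ℂ (fun w => powerRemainder z h J (α w) (β w) k) U := fun k =>
    (differentiable_powerRemainder hz hh hα hβ k).differentiableOn
  have hle : ∀ (k : ℕ) (v : ℂ), v ∈ U → ‖powerRemainder z h J (α v) (β v) k‖ ≤ u k :=
    fun k v hv => hb k _ _ hv.1.1.le hv.1.2.le hv.2.le
  exact ⟨(Complex.differentiableOn_tsum_of_summable_norm hu hd hU hle).analyticAt
    (hU.mem_nhds hwU), Complex.hasSum_deriv_of_summable_norm hu hd hU hle hwU⟩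

/-! ### The Hurwitz zeta function: its pole, and its reality on the real axis -/

theorem tendsto_sub_one_mul_hurwitzZetaPos {z : ℝ} (hz : 0 < z) :
    Tendsto (fun w => (w - 1) * hurwitzZetaPos z w) (𝓝[≠] 1) (𝓝 1) := by
  unfold hurwitzZetaPos
  simp only [mul_sub]
  rw [show (𝓝 (1 : ℂ)) = 𝓝 (1 - 0) by simp]
  refine (HurwitzZeta.hurwitzZeta_residue_one _).sub ?_
  have hmem : 0 < z - ((⌈z⌉₊ - 1 : ℕ) : ℝ) := by
    have h1 : 1 ≤ ⌈z⌉₊ := Nat.one_le_iff_ne_zero.2 (Nat.ceil_pos.2 hz).ne'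
    have h3 := Nat.ceil_lt_add_one hz.le
    rw [Nat.cast_sub h1]
    push_cast
    linarith
  have hc : ContinuousAt (fun w : ℂ => (w - 1) * ∑ m ∈ Finset.range (⌈z⌉₊ - 1),
      1 / ((m : ℂ) + ((z - ((⌈z⌉₊ - 1 : ℕ) : ℝ) : ℝ) : ℂ)) ^ w) 1 := by
    refine ContinuousAt.mul (by fun_prop) (tendsto_finsetSum _ fun m _ => ?_)
    have hne := natCast_add_ofReal_ne_zero hmem m
    refine ContinuousAt.div continuousAt_const ?_ ?_
    · exact (differentiableAt_id.const_cpow (Or.inl hne)).continuousAt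
    · exact fun h => hne (Complex.cpow_eq_zero_iff _ _ |>.1 h).1
  have := hc.tendsto
  simp only [sub_self, zero_mul] at this
  exact this.mono_left nhdsWithin_le_nhds

/-- The entire function `(w - 1) ζ(w, z)`. -/
noncomputable def hurwitzZetaNumerator (z : ℝ) : ℂ → ℂ :=
  Function.update (fun w => (w - 1) * hurwitzZetaPos z w) 1 1

theorem hurwitzZetaNumerator_of_ne (z : ℝ) {w : ℂ} (hw : w ≠ 1) :
    hurwitzZetaNumerator z w = (w - 1) * hurwitzZetaPos z w :=
  Function.update_of_ne hw _ _

theorem hurwitzZetaNumerator_one (z : ℝ) : hurwitzZetaNumerator z 1 = 1 :=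
  Function.update_self _ _ _

theorem differentiable_hurwitzZetaNumerator {z : ℝ} (hz : 0 < z) :
    Differentiable ℂ (hurwitzZetaNumerator z) := by
  have hne : ∀ w : ℂ, w ≠ 1 → DifferentiableAt ℂ (hurwitzZetaNumerator z) w := fun w hw => by
    have : DifferentiableAt ℂ (fun w => (w - 1) * hurwitzZetaPos z w) w :=
      (differentiableAt_id.sub_const 1).mul (differentiableAt_hurwitzZetaPos hz hw)
    refine this.congr_of_eventuallyEq ?_
    filter_upwards [isOpen_ne.mem_nhds hw] with v hv
    exact hurwitzZetaNumerator_of_ne z hv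
  intro w
  rcases eq_or_ne w 1 with rfl | hw
  · refine (Complex.analyticAt_of_differentiable_on_punctured_nhds_of_continuousAt ?_
      (continuousAt_update_same.2 (tendsto_sub_one_mul_hurwitzZetaPos hz))).differentiableAt
    filter_upwards [self_mem_nhdsWithin] with v hv using hne v hv
  · exact hne w hw

theorem meromorphicAt_hurwitzZetaPos {z : ℝ} (hz : 0 < z) (w : ℂ) :
    MeromorphicAt (hurwitzZetaPos z) w := by
  have h : MeromorphicAt (fun w => hurwitzZetaNumerator z w / (w - 1)) w :=
    ((differentiable_hurwitzZetaNumerator hz).analyticAt w).meromorphicAt.div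
      (analyticAt_id.sub analyticAt_const).meromorphicAt
  refine h.congr ?_
  have hev : ∀ᶠ v in 𝓝[≠] w, v ≠ 1 := by
    rcases eq_or_ne w 1 with rfl | hw
    · exact self_mem_nhdsWithin
    · exact nhdsWithin_le_nhds (isOpen_ne.mem_nhds hw)
  filter_upwards [hev] with v hv
  rw [hurwitzZetaNumerator_of_ne z hv, mul_div_cancel_left₀ _ (sub_ne_zero.2 hv)]

theorem hurwitzZetaPos_conj {z : ℝ} (hz : 0 < z) {w : ℂ} (hw : w ≠ 1) :
    (starRingEnd ℂ) (hurwitzZetaPos z ((starRingEnd ℂ) w)) = hurwitzZetaPos z w := by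
  have hpre : IsPreconnected ({1}ᶜ : Set ℂ) :=
    (isConnected_compl_singleton_of_one_lt_rank (by simp) 1).isPreconnected
  have hconj : ∀ v : ℂ, v ≠ 1 → (starRingEnd ℂ) v ≠ 1 := fun v hv h => hv (by
    simpa using congrArg (starRingEnd ℂ) h)
  have hd1 : DifferentiableOn ℂ (fun v => (starRingEnd ℂ) (hurwitzZetaPos z ((starRingEnd ℂ) v)))
      {1}ᶜ := fun v hv => by
    have := (differentiableAt_hurwitzZetaPos hz (hconj v hv)).conj_conj
    rw [Complex.conj_conj] at this
    exact this.differentiableWithinAt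
  have hd2 : DifferentiableOn ℂ (hurwitzZetaPos z) {1}ᶜ := fun v hv =>
    (differentiableAt_hurwitzZetaPos hz hv).differentiableWithinAt
  refine (hd1.analyticOnNhd isOpen_compl_singleton).eqOn_of_preconnected_of_eventuallyEq
    (hd2.analyticOnNhd isOpen_compl_singleton) hpre (z₀ := 2) (by simp) ?_ hw
  have ho : IsOpen {v : ℂ | 1 < v.re} := isOpen_lt continuous_const Complex.continuous_re
  filter_upwards [ho.mem_nhds (show (1 : ℝ) < (2 : ℂ).re by simp)] with v hv
  have h1 := (hasSum_hurwitzZetaPos hz (w := (starRingEnd ℂ) v) (by simpa using hv))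
  have h2 := h1.map (starRingEnd ℂ) Complex.continuous_conj
  refine HasSum.unique ?_ (hasSum_hurwitzZetaPos hz hv)
  convert h2 using 2 with m
  have hx : (0 : ℝ) < m + z := by positivity
  rw [Function.comp_apply, natCast_add_ofReal, map_div₀, map_one, Complex.cpow_conj _ _ ?_, Complex.conj_conj,
    Complex.conj_ofReal]
  rw [Complex.arg_ofReal_of_nonneg hx.le]
  exact Real.pi_pos.ne

/-- By the reflection symmetry of ζ its derivative at 1 - k is real, so the principal logarithm
undoes the exponential and no branch ambiguity arises. -/
theorem milnorGamma_cpow {z : ℝ} (hz : 0 < z) {k : ℕ} (hk : 1 ≤ k) (c : ℂ) :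
    milnorGamma k z ^ c = Complex.exp (c * deriv (hurwitzZetaPos z) (1 - (k : ℂ))) := by
  have hne : (1 - (k : ℂ)) ≠ 1 := by
    have : (k : ℂ) ≠ 0 := by exact_mod_cast (by omega : k ≠ 0)
    simpa using this
  have him : (deriv (hurwitzZetaPos z) (1 - (k : ℂ))).im = 0 := by
    rw [← Complex.conj_eq_iff_im]
    have h1 : deriv (fun v => (starRingEnd ℂ) (hurwitzZetaPos z ((starRingEnd ℂ) v)))
        (1 - (k : ℂ)) = deriv (hurwitzZetaPos z) (1 - (k : ℂ)) := by
      refine Filter.EventuallyEq.deriv_eq ?_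
      filter_upwards [isOpen_ne.mem_nhds hne] with v hv
      exact hurwitzZetaPos_conj hz hv
    have h2 := congrFun (deriv_conj_conj (f := hurwitzZetaPos z)) (1 - (k : ℂ))
    simp only [Function.comp_def, map_sub, map_one, map_natCast] at h2
    rw [← h2, h1]
  rw [milnorGamma, Complex.cpow_def_of_ne_zero (Complex.exp_ne_zero _), Complex.log_exp, mul_comm]
  · rw [him]; linarith [Real.pi_pos]
  · rw [him]; exact Real.pi_pos.le

/-! ### Meromorphic continuation by truncated binomial expansion -/

/-- For `Re α < J - 1` and `|h| < z` this is the meromorphic continuation in `α` of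
`∑ k, (k + z) ^ α (1 - h / (k + z)) ^ β`. -/
noncomputable def powerExpansion (z h : ℝ) (J : ℕ) (α β : ℂ) : ℂ :=
  ∑ j ∈ Finset.range J, Ring.choose β j * (-(h : ℂ)) ^ j * hurwitzZetaPos z (j - α)
    + ∑' k, powerRemainder z h J α β k

/-- Here Re (J - α) > 1, so the zeta value of index J is a convergent series and can be moved back
into the remainder. -/
theorem powerExpansion_succ {z h : ℝ} (hz : 0 < z) (hh : |h| < z) {J : ℕ} {α : ℂ} (β : ℂ)
    (hα : α.re < J - 1) :
    powerExpansion z h (J + 1) α β = powerExpansion z h J α β := by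
  have hs := hasSum_hurwitzZetaPos hz (w := J - α) (by simp; linarith)
  have h1 := (summable_powerRemainder hz hh (J := J + 1) β (by push_cast; linarith)).hasSum
  have h2 := (hs.mul_left (Ring.choose β J * (-(h : ℂ)) ^ J)).add h1
  have hfun : powerRemainder z h J α β = fun k : ℕ => Ring.choose β J * (-(h : ℂ)) ^ J *
      (1 / ((k : ℂ) + z) ^ ((J : ℂ) - α)) + powerRemainder z h (J + 1) α β k := by
    funext k
    have hx := natCast_add_ofReal_ne_zero hz k
    have hx' : ((k : ℂ) + z) ^ α ≠ 0 := by simp [Complex.cpow_eq_zero_iff, hx]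
    rw [powerRemainder, powerRemainder, binomialRemainder_succ, Complex.cpow_sub _ _ hx,
      Complex.cpow_natCast, ← neg_div, div_pow]
    field_simp
  have h3 := h2.tsum_eq
  rw [← hfun] at h3
  rw [powerExpansion, powerExpansion, h3, Finset.sum_range_succ]
  ring

theorem powerExpansion_eq {z h : ℝ} (hz : 0 < z) (hh : |h| < z) {J J' : ℕ} {α : ℂ} (β : ℂ)
    (hJ : α.re < J - 1) (hJ' : α.re < J' - 1) :
    powerExpansion z h J α β = powerExpansion z h J' α β := by
  wlog hle : J ≤ J' generalizing J J'
  · exact (this hJ' hJ (by omega)).symm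
  induction J', hle using Nat.le_induction with
  | base => rfl
  | succ m hm ih =>
    have hlt : α.re < m - 1 := by
      have : (J : ℝ) ≤ m := by exact_mod_cast hm
      linarith
    rw [powerExpansion_succ hz hh β hlt, ih hlt]

theorem hasSum_powerExpansion {z h : ℝ} (hz : 0 < z) (hh : |h| < z) {J : ℕ} {α : ℂ} (β : ℂ)
    (hα : α.re < -1) (hJ : α.re < J - 1) :
    HasSum (fun k : ℕ => ((k : ℂ) + z) ^ α * (1 - h / ((k : ℂ) + z)) ^ β)
      (powerExpansion z h J α β) := by
  have hα' : α.re < (0 : ℕ) - 1 := by simpa using hα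
  rw [powerExpansion_eq hz hh β hJ hα']
  have := (summable_powerRemainder hz hh (J := 0) β hα').hasSum
  have hf : powerRemainder z h 0 α β =
      fun k : ℕ => ((k : ℂ) + z) ^ α * (1 - h / ((k : ℂ) + z)) ^ β := by
    funext k
    simp [powerRemainder, binomialRemainder]
  simpa [powerExpansion, hf] using this

theorem meromorphicAt_hurwitzZetaPos_comp {z : ℝ} (hz : 0 < z) {α : ℂ → ℂ}
    (hα : Differentiable ℂ α) (j : ℕ) (w : ℂ) :
    MeromorphicAt (fun w => hurwitzZetaPos z (j - α w)) w :=
  (meromorphicAt_hurwitzZetaPos hz _).comp_analyticAt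
    (((differentiable_const (j : ℂ)).sub hα).analyticAt w)

theorem meromorphicAt_powerExpansion {z h : ℝ} (hz : 0 < z) (hh : |h| < z) {J : ℕ} {α β : ℂ → ℂ}
    (hα : Differentiable ℂ α) (hβ : Differentiable ℂ β) {w : ℂ} (hw : (α w).re < J - 1) :
    MeromorphicAt (fun w => powerExpansion z h J (α w) (β w)) w := by
  unfold powerExpansion
  refine MeromorphicAt.fun_add (MeromorphicAt.fun_sum fun j _ => ?_)
    (tsum_powerRemainder_aux hz hh hα hβ hw).1.meromorphicAt
  refine MeromorphicAt.fun_mul ?_ (meromorphicAt_hurwitzZetaPos_comp hz hα j w)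
  exact ((((differentiable_ringChoose j).comp hβ).mul_const _).analyticAt w).meromorphicAt

/-- The meromorphic continuation of `w ↦ ∑ k, (k + z) ^ α (1 - h / (k + z)) ^ β` to `ℂ`. -/
noncomputable def powerContinuation (z h : ℝ) (α β : ℂ) : ℂ :=
  powerExpansion z h (⌈α.re⌉₊ + 2) α β

theorem powerContinuation_eq {z h : ℝ} (hz : 0 < z) (hh : |h| < z) {J : ℕ} {α : ℂ} (β : ℂ)
    (hJ : α.re < J - 1) : powerContinuation z h α β = powerExpansion z h J α β := by
  refine powerExpansion_eq hz hh β ?_ hJ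
  push_cast
  linarith [Nat.le_ceil α.re]

/-- The truncation in `powerContinuation` varies with the point; regularity is read off from a fixed
one. -/
theorem powerContinuation_eventuallyEq {z h : ℝ} (hz : 0 < z) (hh : |h| < z) {J : ℕ} {α : ℂ → ℂ}
    (β : ℂ → ℂ) (hα : Differentiable ℂ α) {w : ℂ} (hw : (α w).re < J - 1) :
    (fun w => powerContinuation z h (α w) (β w)) =ᶠ[𝓝 w]
      fun w => powerExpansion z h J (α w) (β w) := by
  have ho : IsOpen {v : ℂ | (α v).re < J - 1} :=
    isOpen_lt (Complex.continuous_re.comp hα.continuous) continuous_const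
  filter_upwards [ho.mem_nhds hw] with v hv using powerContinuation_eq hz hh _ hv

theorem meromorphicAt_powerContinuation {z h : ℝ} (hz : 0 < z) (hh : |h| < z) {α β : ℂ → ℂ}
    (hα : Differentiable ℂ α) (hβ : Differentiable ℂ β) (w : ℂ) :
    MeromorphicAt (fun w => powerContinuation z h (α w) (β w)) w := by
  have hw : (α w).re < ((⌈(α w).re⌉₊ + 2 : ℕ) : ℝ) - 1 := by
    push_cast
    linarith [Nat.le_ceil (α w).re]
  exact (meromorphicAt_powerExpansion hz hh hα hβ hw).congr
    ((powerContinuation_eventuallyEq hz hh β hα hw).symm.filter_mono nhdsWithin_le_nhds)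

/-- Identity theorem for meromorphic functions on a preconnected set. -/
theorem MeromorphicOn.eventuallyEq_nhdsNE_of_isPreconnected {f g : ℂ → ℂ} {U : Set ℂ}
    (hf : MeromorphicOn f U) (hg : MeromorphicOn g U) (hU : IsPreconnected U) {x y : ℂ}
    (hx : x ∈ U) (hy : y ∈ U) (h : f =ᶠ[𝓝 x] g) : f =ᶠ[𝓝[≠] y] g := by
  have hm := hf.sub hg
  have htop : meromorphicOrderAt (f - g) x = ⊤ := by
    rw [meromorphicOrderAt_eq_top_iff]
    refine Eventually.filter_mono nhdsWithin_le_nhds ?_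
    filter_upwards [h] with w hw
    simp [hw]
  have hz : meromorphicOrderAt (f - g) y = ⊤ := by
    by_contra hne
    exact hm.meromorphicOrderAt_ne_top_of_isPreconnected hU hy hx hne htop
  rw [meromorphicOrderAt_eq_top_iff] at hz
  filter_upwards [hz] with w hw
  exact sub_eq_zero.mp hw

/-! ### The binomial coefficient that cancels the pole -/

/-- The polynomial `δ ↦ Ring.choose (b - δ) (a + b + 1) / δ`. -/
noncomputable def chooseQuotient (a b : ℕ) (δ : ℂ) : ℂ :=
  -((∏ i ∈ Finset.range b, ((i + 1 : ℂ) - δ)) * ∏ i ∈ Finset.range a, (-(i + 1 : ℂ) - δ))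
    / (a + b + 1).factorial

theorem ringChoose_sub_eq_mul_chooseQuotient (a b : ℕ) (δ : ℂ) :
    Ring.choose ((b : ℂ) - δ) (a + b + 1) = δ * chooseQuotient a b δ := by
  -- The falling product is split around its factor of index b, which is -δ.
  rw [ringChoose_eq_prod, chooseQuotient, show a + b + 1 = b + (1 + a) by ring,
    Finset.prod_range_add, Finset.prod_range_add, ← Finset.prod_range_reflect _ b]
  have h1 : ∀ i ∈ Finset.range b, (b : ℂ) - δ - ((b - 1 - i : ℕ) : ℂ) = (i + 1 : ℂ) - δ := by
    intro i hi
    rw [Finset.mem_range] at hi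
    have : ((b - 1 - i : ℕ) : ℂ) = b - 1 - i := by
      rw [Nat.cast_sub (by omega), Nat.cast_sub (by omega), Nat.cast_one]
    rw [this]
    ring
  have h2 : ∀ i ∈ Finset.range a, (b : ℂ) - δ - ((b + (1 + i) : ℕ) : ℂ) = -(i + 1 : ℂ) - δ := by
    intro i _
    push_cast
    ring
  rw [Finset.prod_congr rfl h1, Finset.prod_congr rfl h2]
  simp
  ring

theorem hasDerivAt_prod_add_one_sub (n : ℕ) :
    HasDerivAt (fun δ : ℂ => ∏ i ∈ Finset.range n, ((i + 1 : ℂ) - δ))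
      (-(n.factorial * ∑ i ∈ Finset.range n, 1 / (i + 1 : ℂ))) 0 := by
  induction n with
  | zero => simpa using hasDerivAt_const (0 : ℂ) (1 : ℂ)
  | succ n ih =>
    simp_rw [Finset.prod_range_succ]
    have hn : (n + 1 : ℂ) ≠ 0 := Nat.cast_add_one_ne_zero n
    have hv : ∏ i ∈ Finset.range n, ((i + 1 : ℂ) - 0) = n.factorial := by
      simp [← Finset.prod_range_add_one_eq_factorial]
    refine (ih.mul ((hasDerivAt_id (0 : ℂ)).const_sub (n + 1 : ℂ))).congr_deriv ?_
    rw [hv, Nat.factorial_succ, Finset.sum_range_succ]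
    simp only [id]
    push_cast
    field_simp
    ring

theorem hasDerivAt_prod_neg_add_one_sub (n : ℕ) :
    HasDerivAt (fun δ : ℂ => ∏ i ∈ Finset.range n, (-(i + 1 : ℂ) - δ))
      ((-1) ^ n * n.factorial * ∑ i ∈ Finset.range n, 1 / (i + 1 : ℂ)) 0 := by
  have h : (fun δ : ℂ => ∏ i ∈ Finset.range n, (-(i + 1 : ℂ) - δ)) =
      fun δ => (-1) ^ n * ∏ i ∈ Finset.range n, ((i + 1 : ℂ) - -δ) := by
    funext δ
    nth_rw 2 [← Finset.card_range n]
    rw [← Finset.prod_const, ← Finset.prod_mul_distrib]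
    exact Finset.prod_congr rfl fun i _ => by ring
  rw [h]
  have h0 := hasDerivAt_prod_add_one_sub n
  rw [← neg_zero] at h0
  refine ((h0.comp (0 : ℂ) (hasDerivAt_neg (0 : ℂ))).const_mul ((-1) ^ n)).congr_deriv ?_
  ring

/-- Product rule: the two blocks of factors contribute harmonic numbers of opposite sign. For b = a
+ d their difference is H(r, r+d-1). -/
theorem hasDerivAt_chooseQuotient (a b : ℕ) :
    HasDerivAt (chooseQuotient a b) ((-1) ^ a * a.factorial * b.factorial *
      ((∑ i ∈ Finset.range b, 1 / (i + 1 : ℂ)) - ∑ i ∈ Finset.range a, 1 / (i + 1 : ℂ))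
        / (a + b + 1).factorial) 0 := by
  have hb : ∏ i ∈ Finset.range b, ((i + 1 : ℂ) - 0) = b.factorial := by
    simp [← Finset.prod_range_add_one_eq_factorial]
  have ha : ∏ i ∈ Finset.range a, (-(i + 1 : ℂ) - 0) = (-1) ^ a * a.factorial := by
    rw [← Finset.prod_range_add_one_eq_factorial]
    push_cast
    nth_rw 2 [← Finset.card_range a]
    rw [← Finset.prod_const, ← Finset.prod_mul_distrib]
    exact Finset.prod_congr rfl fun i _ => by ring
  refine (((hasDerivAt_prod_add_one_sub b).mul
    (hasDerivAt_prod_neg_add_one_sub a)).neg.div_const _).congr_deriv ?_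
  rw [ha, hb]
  ring

theorem differentiable_chooseQuotient (a b : ℕ) : Differentiable ℂ (chooseQuotient a b) := by
  unfold chooseQuotient
  fun_prop

/-! ### The family in m and its derivative at ε = 0 -/

/-- The function `ε ↦ powerExpansion z h (a + b + 2) (a + b - 2 ε) (b - m ε)` with its removable
singularity at `ε = 0` removed. -/
noncomputable def regularizedExpansion (z h : ℝ) (a b : ℕ) (m ε : ℂ) : ℂ :=
  (∑ j ∈ Finset.range (a + b + 1), Ring.choose ((b : ℂ) - m * ε) j *
      ((-(h : ℂ)) ^ j * hurwitzZetaPos z (j - ((a + b : ℂ) - 2 * ε))))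
    + (-(h : ℂ)) ^ (a + b + 1) / 2 *
      (m * (chooseQuotient a b (m * ε) * hurwitzZetaNumerator z (1 + 2 * ε)))
    + ∑' k, powerRemainder z h (a + b + 2) ((a + b : ℂ) - 2 * ε) ((b : ℂ) - m * ε) k

theorem regularizedExpansion_eq (z h : ℝ) (a b : ℕ) (m : ℂ) {ε : ℂ} (hε : ε ≠ 0) :
    regularizedExpansion z h a b m ε =
      powerExpansion z h (a + b + 2) ((a + b : ℂ) - 2 * ε) ((b : ℂ) - m * ε) := by
  have h1 : (1 : ℂ) + 2 * ε ≠ 1 := by simpa using hε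
  rw [regularizedExpansion, powerExpansion, Finset.sum_range_succ (n := a + b + 1),
    ringChoose_sub_eq_mul_chooseQuotient, hurwitzZetaNumerator_of_ne z h1]
  have h2 : ((a + b + 1 : ℕ) : ℂ) - ((a + b : ℂ) - 2 * ε) = 1 + 2 * ε := by push_cast; ring
  rw [h2]
  simp only [mul_assoc]
  congr 2
  ring

theorem analyticAt_hurwitzZetaPos_shift {z : ℝ} (hz : 0 < z) {N j : ℕ} (hj : j ≤ N) :
    AnalyticAt ℂ (fun ε : ℂ => hurwitzZetaPos z (j - ((N : ℂ) - 2 * ε))) 0 ∧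
    deriv (fun ε : ℂ => hurwitzZetaPos z (j - ((N : ℂ) - 2 * ε))) 0 =
      2 * deriv (hurwitzZetaPos z) (j - (N : ℂ)) := by
  have hne : (j : ℂ) - N ≠ 1 := by
    intro h
    have : (j : ℂ) = ((N + 1 : ℕ) : ℂ) := by push_cast; linear_combination h
    have := Nat.cast_injective this
    omega
  have h1 : HasDerivAt (fun ε : ℂ => (j : ℂ) - ((N : ℂ) - 2 * ε)) 2 0 := by
    simpa using (((hasDerivAt_id (0 : ℂ)).const_mul 2).const_sub (N : ℂ)).const_sub (j : ℂ)
  have h2 := HasDerivAt.comp_of_eq (0 : ℂ) (differentiableAt_hurwitzZetaPos hz hne).hasDerivAt h1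
    (by simp)
  have h3 : AnalyticAt ℂ (hurwitzZetaPos z) (j - (N : ℂ)) :=
    DifferentiableOn.analyticAt (s := {1}ᶜ)
      (fun v hv => (differentiableAt_hurwitzZetaPos hz hv).differentiableWithinAt)
      (isOpen_compl_singleton.mem_nhds hne)
  exact ⟨h3.comp_of_eq (by fun_prop) (by simp), h2.deriv.trans (mul_comm _ _)⟩

theorem analyticAt_regularizedExpansion {z h : ℝ} (hz : 0 < z) (hh : |h| < z) (a b : ℕ) (m : ℂ) :
    AnalyticAt ℂ (regularizedExpansion z h a b m) 0 := by
  unfold regularizedExpansion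
  refine AnalyticAt.fun_add (AnalyticAt.fun_add ?_ ?_) ?_
  · refine Finset.analyticAt_fun_sum _ fun j hj => ?_
    have hζ := (analyticAt_hurwitzZetaPos_shift hz (N := a + b)
      (Nat.lt_succ_iff.1 (Finset.mem_range.1 hj))).1
    push_cast at hζ
    refine AnalyticAt.fun_mul (Differentiable.analyticAt ?_ 0) (analyticAt_const.fun_mul hζ)
    exact (differentiable_ringChoose j).comp (by fun_prop)
  · refine Differentiable.analyticAt (Differentiable.const_mul (Differentiable.const_mul
      (Differentiable.mul ?_ ?_) _) _) 0
    · exact (differentiable_chooseQuotient a b).comp (by fun_prop)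
    · exact (differentiable_hurwitzZetaNumerator hz).comp (by fun_prop)
  · refine (tsum_powerRemainder_aux hz hh (α := fun ε => (a + b : ℂ) - 2 * ε)
      (β := fun ε => (b : ℂ) - m * ε) (by fun_prop) (by fun_prop) ?_).1
    simp
    linarith

/-- The point is that the derivative is affine in m, since `f b` and `g` do not involve m. -/
theorem hasDerivAt_comp_sub_mul {f g : ℂ → ℂ} {b : ℂ} (hf : DifferentiableAt ℂ f b)
    (hg : DifferentiableAt ℂ g 0) (m : ℂ) :
    HasDerivAt (fun ε => f (b - m * ε) * g ε)
      (f b * deriv g 0 + m * (-(deriv f b) * g 0)) 0 := by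
  have h1 : HasDerivAt (fun ε : ℂ => b - m * ε) (-m) 0 := by
    simpa using ((hasDerivAt_id (0 : ℂ)).const_mul m).const_sub b
  have h2 : HasDerivAt (fun ε => f (b - m * ε)) (deriv f b * -m) 0 :=
    HasDerivAt.comp_of_eq (0 : ℂ) hf.hasDerivAt h1 (by simp)
  refine (h2.mul hg.hasDerivAt).congr_deriv ?_
  simp
  ring

theorem exists_hasDerivAt_comp_sub_mul {f g : ℂ → ℂ} {b : ℂ} (hf : DifferentiableAt ℂ f b)
    (hg : DifferentiableAt ℂ g 0) :
    ∃ P Q : ℂ, ∀ m : ℂ, HasDerivAt (fun ε => f (b - m * ε) * g ε) (P + m * Q) 0 :=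
  ⟨_, _, hasDerivAt_comp_sub_mul hf hg⟩

/-- The derivative at `0` of the regularized expansion is a quadratic polynomial in `m`. -/
theorem exists_hasDerivAt_regularizedExpansion {z h : ℝ} (hz : 0 < z) (hh : |h| < z) (a b : ℕ) :
    ∃ P Q : ℂ, ∀ m : ℂ, HasDerivAt (regularizedExpansion z h a b m)
      (P + m * Q + m ^ 2 * ((-(h : ℂ)) ^ (a + b + 1) / 2 * deriv (chooseQuotient a b) 0)) 0 := by
  have hrem : ∃ P Q : ℂ, ∀ m : ℂ, HasDerivAt (fun ε : ℂ => ∑' k,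
      powerRemainder z h (a + b + 2) ((a + b : ℂ) - 2 * ε) ((b : ℂ) - m * ε) k)
      (P + m * Q) 0 := by
    have hterm : ∀ k : ℕ, ∃ p q : ℂ, ∀ m : ℂ, HasDerivAt (fun ε : ℂ =>
        powerRemainder z h (a + b + 2) ((a + b : ℂ) - 2 * ε) ((b : ℂ) - m * ε) k)
        (p + m * q) 0 := fun k => by
      have hg : DifferentiableAt ℂ (fun ε : ℂ => ((k : ℂ) + z) ^ ((a + b : ℂ) - 2 * ε)) 0 :=
        DifferentiableAt.const_cpow (by fun_prop) (Or.inl (natCast_add_ofReal_ne_zero hz k))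
      have hf := differentiable_binomialRemainder (J := a + b + 2)
        (Complex.slitPlane_ne_zero (one_sub_div_mem_slitPlane hz hh k)) (b : ℂ)
      obtain ⟨p, q, h⟩ := exists_hasDerivAt_comp_sub_mul hf hg
      refine ⟨p, q, fun m => ?_⟩
      simpa only [powerRemainder, mul_comm (binomialRemainder _ _ _)] using h m
    choose p q hpq using hterm
    have hsum := fun m : ℂ => tsum_powerRemainder_aux hz hh (J := a + b + 2)
      (α := fun ε => (a + b : ℂ) - 2 * ε) (β := fun ε => (b : ℂ) - m * ε) (by fun_prop)
      (by fun_prop) (w := 0) (by simp; linarith)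
    have hsum' : ∀ m : ℂ, HasSum (fun k => p k + m * q k) _ := fun m => by
      have := (hsum m).2
      simpa only [fun k => (hpq k m).deriv] using this
    refine ⟨∑' k, p k, ∑' k, q k, fun m => ?_⟩
    -- Summability for m = 0 and m = 1 separates the two coefficient series.
    have hp : Summable p := by simpa using (hsum' 0).summable
    have hq : Summable q := by simpa using (hsum' 1).summable.sub hp
    rw [← tsum_mul_left, ← hp.tsum_add (hq.mul_left m), (hsum' m).tsum_eq]
    exact (hsum m).1.differentiableAt.hasDerivAt
  obtain ⟨P, Q, hPQ⟩ := hrem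
  have hfin : ∃ P Q : ℂ, ∀ m : ℂ, HasDerivAt (fun ε : ℂ => ∑ j ∈ Finset.range (a + b + 1),
      Ring.choose ((b : ℂ) - m * ε) j *
        ((-(h : ℂ)) ^ j * hurwitzZetaPos z (j - ((a + b : ℂ) - 2 * ε)))) (P + m * Q) 0 := by
    have hterm : ∀ j : ℕ, ∃ p q : ℂ, ∀ m : ℂ, j ∈ Finset.range (a + b + 1) →
        HasDerivAt (fun ε : ℂ => Ring.choose ((b : ℂ) - m * ε) j *
          ((-(h : ℂ)) ^ j * hurwitzZetaPos z (j - ((a + b : ℂ) - 2 * ε)))) (p + m * q) 0 := by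
      intro j
      by_cases hj : j ∈ Finset.range (a + b + 1)
      · have hg := (analyticAt_hurwitzZetaPos_shift hz (N := a + b)
          (Nat.lt_succ_iff.1 (Finset.mem_range.1 hj))).1.differentiableAt.const_mul
            ((-(h : ℂ)) ^ j)
        push_cast at hg
        obtain ⟨p, q, h⟩ := exists_hasDerivAt_comp_sub_mul (differentiable_ringChoose j (b : ℂ)) hg
        exact ⟨p, q, fun m _ => h m⟩
      · exact ⟨0, 0, fun m h => absurd h hj⟩
    choose p q hpq using hterm
    refine ⟨∑ j ∈ Finset.range (a + b + 1), p j, ∑ j ∈ Finset.range (a + b + 1), q j,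
      fun m => ?_⟩
    rw [Finset.mul_sum, ← Finset.sum_add_distrib]
    exact HasDerivAt.fun_sum fun j hj => hpq j m hj
  obtain ⟨P', Q', hPQ'⟩ := hfin
  have hpole : ∃ Q : ℂ, ∀ m : ℂ, HasDerivAt (fun ε : ℂ => (-(h : ℂ)) ^ (a + b + 1) / 2 *
      (m * (chooseQuotient a b (m * ε) * hurwitzZetaNumerator z (1 + 2 * ε))))
      (m * Q + m ^ 2 * ((-(h : ℂ)) ^ (a + b + 1) / 2 * deriv (chooseQuotient a b) 0)) 0 := by
    have hg : DifferentiableAt ℂ (fun ε : ℂ => hurwitzZetaNumerator z (1 + 2 * ε)) 0 :=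
      ((differentiable_hurwitzZetaNumerator hz).comp (by fun_prop)) 0
    refine ⟨(-(h : ℂ)) ^ (a + b + 1) / 2 * (chooseQuotient a b 0 *
      deriv (fun ε : ℂ => hurwitzZetaNumerator z (1 + 2 * ε)) 0), fun m => ?_⟩
    -- The outer factor m raises the affine dependence to a quadratic one; the residue 1 of ζ fixes
    -- the coefficient of m ^ 2.
    have h1 := hasDerivAt_comp_sub_mul (differentiable_chooseQuotient a b 0) hg (-m)
    refine ((((h1.congr_of_eventuallyEq ?_).const_mul m).const_mul _).congr_deriv ?_)
    · exact Eventually.of_forall fun ε => by simp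
    · rw [mul_zero, add_zero, hurwitzZetaNumerator_one]
      ring
  obtain ⟨Q'', hQ''⟩ := hpole
  refine ⟨P' + P, Q' + Q'' + Q, fun m => ?_⟩
  refine (((hPQ' m).add (hQ'' m)).add (hPQ m)).congr_deriv ?_
  ring

/-- For a quadratic p with leading coefficient R, p(1) = (p(0) + p(2))/2 - R. -/
theorem deriv_regularizedExpansion_one {z h : ℝ} (hz : 0 < z) (hh : |h| < z) (a b : ℕ) :
    deriv (regularizedExpansion z h a b 1) 0 =
      (deriv (regularizedExpansion z h a b 0) 0 + deriv (regularizedExpansion z h a b 2) 0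
        - (-(h : ℂ)) ^ (a + b + 1) * deriv (chooseQuotient a b) 0) / 2 := by
  obtain ⟨P, Q, hPQ⟩ := exists_hasDerivAt_regularizedExpansion hz hh a b
  rw [(hPQ 0).deriv, (hPQ 1).deriv, (hPQ 2).deriv]
  ring

/-! ### The endpoints m = 0 and m = 2 as finite Hurwitz sums -/

/-- A finite linear combination of Hurwitz zeta values, which continues
`∑ k, (k + z) ^ (N - c - 2 ε) (k + z + h) ^ c`. -/
noncomputable def hurwitzSum (z h : ℝ) (N c : ℕ) (ε : ℂ) : ℂ :=
  ∑ j ∈ Finset.range (c + 1), (c.choose j : ℂ) *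
    ((h : ℂ) ^ j * hurwitzZetaPos z (j - ((N : ℂ) - 2 * ε)))

theorem deriv_hurwitzSum {z : ℝ} (hz : 0 < z) (h : ℝ) {N c : ℕ} (hc : c ≤ N) :
    AnalyticAt ℂ (hurwitzSum z h N c) 0 ∧ deriv (hurwitzSum z h N c) 0 =
      2 * ∑ j ∈ Finset.range (c + 1), (c.choose j : ℂ) *
        ((h : ℂ) ^ j * deriv (hurwitzZetaPos z) (j - (N : ℂ))) := by
  have hζ : ∀ j ∈ Finset.range (c + 1), _ := fun j hj => analyticAt_hurwitzZetaPos_shift hz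
    ((Nat.lt_succ_iff.1 (Finset.mem_range.1 hj)).trans hc)
  unfold hurwitzSum
  refine ⟨Finset.analyticAt_fun_sum _ fun j hj =>
    analyticAt_const.fun_mul (analyticAt_const.fun_mul (hζ j hj).1), ?_⟩
  rw [deriv_fun_sum fun j hj => (((hζ j hj).1.differentiableAt.const_mul _).const_mul _),
    Finset.mul_sum]
  refine Finset.sum_congr rfl fun j hj => ?_
  rw [deriv_const_mul _ ((hζ j hj).1.differentiableAt.const_mul _),
    deriv_const_mul _ (hζ j hj).1.differentiableAt, (hζ j hj).2]
  ring

/-- With exponent b the binomial series terminates, so the remainder vanishes. -/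
theorem regularizedExpansion_zero (z h : ℝ) (a b : ℕ) :
    regularizedExpansion z h a b 0 = hurwitzSum z (-h) (a + b) b := by
  funext ε
  have h1 : ∀ k, powerRemainder z h (a + b + 2) ((a + b : ℂ) - 2 * ε) (b : ℂ) k = 0 := fun k => by
    rw [powerRemainder, binomialRemainder_natCast (by omega), mul_zero]
  simp only [regularizedExpansion, zero_mul, sub_zero, h1, tsum_zero, mul_zero, add_zero,
    hurwitzSum, Ring.choose_natCast]
  push_cast
  symm
  refine Finset.sum_subset (Finset.range_mono (by omega)) fun j _ hj => ?_
  rw [Nat.choose_eq_zero_of_lt (by simpa using hj), Nat.cast_zero, zero_mul]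

theorem hasSum_hurwitzSum {z : ℝ} (hz : 0 < z) {h : ℝ} {N c : ℕ} {ε : ℂ}
    (hε : ((N : ℂ) - 2 * ε).re < -1) :
    HasSum (fun k : ℕ => ((k : ℂ) + z) ^ ((N : ℂ) - 2 * ε - c) * ((k : ℂ) + (z + h : ℝ)) ^ c)
      (hurwitzSum z h N c ε) := by
  have hsum := hasSum_sum (s := Finset.range (c + 1)) fun j _ =>
    ((hasSum_hurwitzZetaPos hz (w := j - ((N : ℂ) - 2 * ε)) (by
      rw [Complex.sub_re, Complex.natCast_re]
      linarith [(Nat.cast_nonneg j : (0 : ℝ) ≤ j)])).mul_left ((h : ℂ) ^ j)).mul_left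
        (c.choose j : ℂ)
  refine hsum.congr_fun fun k => ?_
  have hx := natCast_add_ofReal_ne_zero hz k
  have he : (k : ℂ) + (z + h : ℝ) = h + ((k : ℂ) + z) := by push_cast; ring
  rw [he, add_pow, Finset.mul_sum]
  refine Finset.sum_congr rfl fun j hj => ?_
  have hj' : j ≤ c := Nat.lt_succ_iff.1 (Finset.mem_range.1 hj)
  have hpow : ((k : ℂ) + z) ^ ((N : ℂ) - 2 * ε - c) * ((k : ℂ) + z) ^ (c - j) =
      1 / ((k : ℂ) + z) ^ ((j : ℂ) - ((N : ℂ) - 2 * ε)) := by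
    rw [one_div, ← Complex.cpow_neg, ← Complex.cpow_natCast, ← Complex.cpow_add _ _ hx,
      Nat.cast_sub hj']
    congr 1
    ring
  rw [← hpow]
  ring

theorem one_sub_div_cpow {z h : ℝ} (hz : 0 < z) (hh : |h| < z) (k : ℕ) (β : ℂ) :
    (1 - h / ((k : ℂ) + z)) ^ β = ((k : ℂ) + (z - h : ℝ)) ^ β / ((k : ℂ) + z) ^ β := by
  have hx : (0 : ℝ) < k + z := by positivity
  have hy : (0 : ℝ) < k + (z - h) := by
    linarith [le_abs_self h, (Nat.cast_nonneg k : (0 : ℝ) ≤ k)]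
  have h1 : 1 - (h : ℂ) / ((k : ℂ) + z) = (((k + (z - h)) / (k + z) : ℝ) : ℂ) := by
    have hne : ((k : ℂ) + z) ≠ 0 := natCast_add_ofReal_ne_zero hz k
    push_cast
    field_simp
    ring
  rw [h1, natCast_add_ofReal, natCast_add_ofReal, div_eq_mul_inv, Complex.ofReal_mul,
    Complex.mul_cpow_ofReal_nonneg hy.le (by positivity), Complex.ofReal_inv, Complex.inv_cpow,
    div_eq_mul_inv]
  rw [Complex.arg_ofReal_of_nonneg hx.le]
  exact Real.pi_pos.ne

/-- At m = 2 the first base carries the natural exponent a. Both sides continue the same series, now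
expanded around z - h, so the identity theorem applies. -/
theorem regularizedExpansion_two {z h : ℝ} (hz : 0 < z) (hh : |h| < z) (a b : ℕ) :
    regularizedExpansion z h a b 2 =ᶠ[𝓝 0] hurwitzSum (z - h) h (a + b) a := by
  have hy : 0 < z - h := by linarith [le_abs_self h]
  have han := analyticAt_regularizedExpansion hz hh a b 2
  have han' := (deriv_hurwitzSum hy h (Nat.le_add_right a b)).1
  rw [← han.continuousAt.eventuallyEq_nhds_iff_eventuallyEq_nhdsNE han'.continuousAt]
  -- On this half-plane the fixed truncation a + b + 2 is valid; it contains 0 and the point a + b +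
  -- 1, near which the series itself converges.
  let U : Set ℂ := {ε | -1 / 2 < ε.re}
  have hre : ∀ ε : ℂ, ((a + b : ℂ) - 2 * ε).re = a + b - 2 * ε.re := fun ε => by simp
  have hlt : ∀ ε ∈ U, ((a + b : ℂ) - 2 * ε).re < ((a + b + 2 : ℕ) : ℝ) - 1 := fun ε hε => by
    have : -1 / 2 < ε.re := hε
    rw [hre]
    push_cast
    linarith
  have hm1 : MeromorphicOn (fun ε : ℂ =>
      powerExpansion z h (a + b + 2) ((a + b : ℂ) - 2 * ε) ((b : ℂ) - 2 * ε)) U := fun ε hε =>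
    meromorphicAt_powerExpansion hz hh (α := fun ε => (a + b : ℂ) - 2 * ε)
      (β := fun ε => (b : ℂ) - 2 * ε) (by fun_prop) (by fun_prop) (hlt ε hε)
  have hm2 : MeromorphicOn (hurwitzSum (z - h) h (a + b) a) U := fun ε _ => by
    unfold hurwitzSum
    refine MeromorphicAt.fun_sum fun j _ => (MeromorphicAt.const _ _).fun_mul
      ((MeromorphicAt.const _ _).fun_mul ?_)
    exact meromorphicAt_hurwitzZetaPos_comp hy (by fun_prop) j ε
  have hpre : IsPreconnected U := (convex_halfSpace_re_gt _).isPreconnected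
  have h0 : (0 : ℂ) ∈ U := by simp [U]; norm_num
  have h1 : ((a + b + 1 : ℕ) : ℂ) ∈ U := by
    simp only [U, Set.mem_ofPred_eq, Complex.natCast_re]
    have : (0 : ℝ) ≤ ((a + b + 1 : ℕ) : ℝ) := Nat.cast_nonneg _
    linarith
  have hev := hm1.eventuallyEq_nhdsNE_of_isPreconnected hm2 hpre h1 h0 ?_
  · refine Filter.EventuallyEq.trans ?_ hev
    filter_upwards [self_mem_nhdsWithin] with ε hε using regularizedExpansion_eq z h a b 2 hε
  · have ho : IsOpen {ε : ℂ | ((a + b : ℂ) - 2 * ε).re < -1} := by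
      simp_rw [hre]
      exact isOpen_lt (by fun_prop) continuous_const
    have hmem : ((a + b + 1 : ℕ) : ℂ) ∈ {ε : ℂ | ((a + b : ℂ) - 2 * ε).re < -1} := by
      rw [Set.mem_ofPred_eq, hre, Complex.natCast_re]
      push_cast
      linarith [(Nat.cast_nonneg a : (0 : ℝ) ≤ a), (Nat.cast_nonneg b : (0 : ℝ) ≤ b)]
    filter_upwards [ho.mem_nhds hmem] with ε hε
    have hε' : ((a + b : ℂ) - 2 * ε).re < ((a + b + 2 : ℕ) : ℝ) - 1 := by
      refine lt_of_lt_of_le hε ?_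
      push_cast
      linarith [(Nat.cast_nonneg a : (0 : ℝ) ≤ a), (Nat.cast_nonneg b : (0 : ℝ) ≤ b)]
    have hs := hasSum_powerExpansion hz hh ((b : ℂ) - 2 * ε) hε hε'
    have hs' := hasSum_hurwitzSum (N := a + b) (c := a) (h := h) hy
      (by push_cast; exact hε)
    refine hs.unique (hs'.congr_fun fun k => ?_)
    have hx := natCast_add_ofReal_ne_zero hz k
    rw [one_sub_div_cpow hz hh, mul_div_assoc', div_eq_mul_inv, mul_right_comm,
      ← div_eq_mul_inv, ← Complex.cpow_sub _ _ hx, sub_add_cancel]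
    push_cast
    rw [show ((a : ℂ) + b - 2 * ε - (b - 2 * ε)) = (a : ℕ) by ring, Complex.cpow_natCast, mul_comm]
    congr 2
    ring

/-- The derivative at the pole-free point `ε = 0` of the continuation of
`∑ k, (k + z) ^ (a - ε) (k + z - h) ^ (b - ε)`. -/
theorem deriv_regularizedExpansion_one_eq {z h : ℝ} (hz : 0 < z) (hh : |h| < z) (a b : ℕ) :
    deriv (regularizedExpansion z h a b 1) 0 =
      (∑ j ∈ Finset.range (b + 1), (b.choose j : ℂ) *
        ((-(h : ℂ)) ^ j * deriv (hurwitzZetaPos z) (j - ((a + b : ℕ) : ℂ)))) +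
      (∑ j ∈ Finset.range (a + 1), (a.choose j : ℂ) *
        ((h : ℂ) ^ j * deriv (hurwitzZetaPos (z - h)) (j - ((a + b : ℕ) : ℂ)))) -
      (-(h : ℂ)) ^ (a + b + 1) * deriv (chooseQuotient a b) 0 / 2 := by
  have hy : 0 < z - h := by linarith [le_abs_self h]
  rw [deriv_regularizedExpansion_one hz hh, regularizedExpansion_zero,
    (regularizedExpansion_two hz hh a b).deriv_eq, (deriv_hurwitzSum hy h (by omega)).2,
    (deriv_hurwitzSum hz (-h) (by omega)).2]
  push_cast
  ring

/-! ### Return to the two-variable Hurwitz zeta function -/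

theorem twoVarHurwitzTerm_eq {z h : ℝ} (hz : 0 < z) (hh : |h| < z) (w : ℂ) (d k : ℕ) :
    twoVarHurwitzTerm z (z - h) w (w - (d : ℂ)) k =
      ((k : ℂ) + z) ^ ((d : ℂ) - 2 * w) * (1 - h / ((k : ℂ) + z)) ^ ((d : ℂ) - w) := by
  have hx := natCast_add_ofReal_ne_zero hz k
  have h1 : ((k : ℂ) + z) ^ ((d : ℂ) - 2 * w) =
      ((k : ℂ) + z) ^ (-w) * ((k : ℂ) + z) ^ ((d : ℂ) - w) := by
    rw [← Complex.cpow_add _ _ hx]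
    congr 1
    ring
  have h2 : ((k : ℂ) + z) ^ ((d : ℂ) - w) ≠ 0 := by simp [Complex.cpow_eq_zero_iff, hx]
  rw [twoVarHurwitzTerm, one_sub_div_cpow hz hh, h1, one_div, mul_inv, ← Complex.cpow_neg,
    ← Complex.cpow_neg, neg_sub]
  field_simp

theorem isMeromorphicContinuation_twoVarHurwitzDiag {z h : ℝ} (hz : 0 < z) (hh : |h| < z) (d : ℕ) :
    IsMeromorphicContinuation (fun k w => twoVarHurwitzTerm z (z - h) w (w - (d : ℂ)) k)
      (((d : ℝ) + 1) / 2) (twoVarHurwitzDiag z (z - h) d) := by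
  refine Classical.epsilon_spec (p := IsMeromorphicContinuation _ _) ⟨toMeromorphicNFOn
    (fun w => powerContinuation z h ((d : ℂ) - 2 * w) ((d : ℂ) - w)) Set.univ,
    meromorphicNFOn_toMeromorphicNFOn _ _, fun w hw => ?_⟩
  have hm : MeromorphicOn (fun w : ℂ => powerContinuation z h ((d : ℂ) - 2 * w) ((d : ℂ) - w))
      Set.univ := fun w _ => meromorphicAt_powerContinuation hz hh
        (α := fun w => (d : ℂ) - 2 * w) (β := fun w => (d : ℂ) - w) (by fun_prop) (by fun_prop) w
  have hre : ((d : ℂ) - 2 * w).re < -1 := by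
    simp
    linarith
  have hre0 : ((d : ℂ) - 2 * w).re < (0 : ℕ) - 1 := by simpa using hre
  have han : AnalyticAt ℂ
      (fun w : ℂ => powerContinuation z h ((d : ℂ) - 2 * w) ((d : ℂ) - w)) w := by
    refine AnalyticAt.congr ?_ (powerContinuation_eventuallyEq hz hh
      (fun w : ℂ => (d : ℂ) - w) (α := fun w => (d : ℂ) - 2 * w) (by fun_prop) hre0).symm
    have := (tsum_powerRemainder_aux hz hh (α := fun w => (d : ℂ) - 2 * w)
      (β := fun w => (d : ℂ) - w) (by fun_prop) (by fun_prop) hre0).1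
    simpa [powerExpansion] using this
  -- Passing to normal form changes no value where the function is already analytic, in particular
  -- in the half-plane of convergence.
  rw [toMeromorphicNFOn_eq_toMeromorphicNFAt hm (Set.mem_univ w),
    toMeromorphicNFAt_eq_self.2 han.meromorphicNFAt]
  beta_reduce
  rw [powerContinuation_eq hz hh _ hre0]
  simp_rw [twoVarHurwitzTerm_eq hz hh]
  exact hasSum_powerExpansion hz hh _ hre hre0

theorem twoVarHurwitzDiag_eventuallyEq {z h : ℝ} (hz : 0 < z) (hh : |h| < z) (a d : ℕ) :
    twoVarHurwitzDiag z (z - h) d =ᶠ[𝓝 (-(a : ℂ))]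
      fun w => regularizedExpansion z h a (a + d) 1 (w + a) := by
  obtain ⟨hnf, hs⟩ := isMeromorphicContinuation_twoVarHurwitzDiag hz hh d
  have han : AnalyticAt ℂ (fun w => regularizedExpansion z h a (a + d) 1 (w + a)) (-(a : ℂ)) :=
    (analyticAt_regularizedExpansion hz hh a (a + d) 1).comp_of_eq (by fun_prop) (by simp)
  rw [← (hnf (Set.mem_univ _)).eventuallyEq_nhdsNE_iff_eventuallyEq_nhds han.meromorphicNFAt]
  have hm : MeromorphicOn (fun w : ℂ => powerContinuation z h ((d : ℂ) - 2 * w) ((d : ℂ) - w))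
      Set.univ := fun w _ => meromorphicAt_powerContinuation hz hh
        (α := fun w => (d : ℂ) - 2 * w) (β := fun w => (d : ℂ) - w) (by fun_prop) (by fun_prop) w
  have hloc : twoVarHurwitzDiag z (z - h) d =ᶠ[𝓝 ((d + 1 : ℕ) : ℂ)]
      fun w : ℂ => powerContinuation z h ((d : ℂ) - 2 * w) ((d : ℂ) - w) := by
    have ho : IsOpen {w : ℂ | ((d : ℝ) + 1) / 2 < w.re} :=
      isOpen_lt continuous_const Complex.continuous_re
    have hmem : ((d + 1 : ℕ) : ℂ) ∈ {w : ℂ | ((d : ℝ) + 1) / 2 < w.re} := by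
      rw [Set.mem_ofPred_eq, Complex.natCast_re]
      push_cast
      linarith [(Nat.cast_nonneg d : (0 : ℝ) ≤ d)]
    filter_upwards [ho.mem_nhds hmem] with w hw
    have hw' : ((d : ℝ) + 1) / 2 < w.re := hw
    have hre : ((d : ℂ) - 2 * w).re < -1 := by
      simp
      linarith
    have hre0 : ((d : ℂ) - 2 * w).re < (0 : ℕ) - 1 := by simpa using hre
    have hsw := hs w hw
    simp_rw [twoVarHurwitzTerm_eq hz hh] at hsw
    rw [powerContinuation_eq hz hh _ hre0]
    exact hsw.unique (hasSum_powerExpansion hz hh _ hre hre0)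
  have hev := (hnf.meromorphicOn).eventuallyEq_nhdsNE_of_isPreconnected hm isPreconnected_univ
    (Set.mem_univ _) (Set.mem_univ (-(a : ℂ))) hloc
  -- At w = -a the exponent is 2a + d, and this is the least admissible truncation.
  have hev' := powerContinuation_eventuallyEq hz hh (J := a + (a + d) + 2)
    (fun w : ℂ => (d : ℂ) - w) (α := fun w => (d : ℂ) - 2 * w) (w := -(a : ℂ)) (by fun_prop) (by
      simp
      linarith)
  refine hev.trans ((hev'.filter_mono nhdsWithin_le_nhds).trans ?_)
  filter_upwards [self_mem_nhdsWithin] with w hw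
  have hne : w + a ≠ 0 := fun h => hw (eq_neg_of_add_eq_zero_left h)
  rw [regularizedExpansion_eq z h a (a + d) 1 hne]
  congr 1 <;> push_cast <;> ring

/-! ### Matching constants, signs and index ranges -/

theorem harmonicBetween_eq (a d : ℕ) :
    ((harmonicBetween (a + 1) (a + d) : ℝ) : ℂ) =
      (∑ i ∈ Finset.range (a + d), 1 / (i + 1 : ℂ)) - ∑ i ∈ Finset.range a, 1 / (i + 1 : ℂ) := by
  rw [Finset.sum_range_add, add_sub_cancel_left, harmonicBetween, ← Finset.Ico_add_one_right_eq_Icc,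
    Finset.sum_Ico_eq_sum_range, show a + d + 1 - (a + 1) = d by omega]
  push_cast
  refine Finset.sum_congr rfl fun i _ => ?_
  ring

theorem neg_pow_mul_deriv_chooseQuotient (a d : ℕ) (h : ℝ) :
    (-(h : ℂ)) ^ (a + (a + d) + 1) * deriv (chooseQuotient a (a + d)) 0 / 2 =
      (((-1 : ℝ) ^ (a + 1 + d) * (a.factorial : ℝ) / (2 * ((a + 1 + d).ascFactorial (a + 1) : ℝ))
            * harmonicBetween (a + 1) (a + d) * h ^ (a + (a + d) + 1) : ℝ) : ℂ) := by
  have hfac : ((a + d).factorial : ℂ) * ((a + 1 + d).ascFactorial (a + 1) : ℂ) =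
      ((a + (a + d) + 1).factorial : ℂ) := by
    have := Nat.factorial_mul_ascFactorial (a + d) (a + 1)
    rw [show a + d + 1 = a + 1 + d by ring, show a + d + (a + 1) = a + (a + d) + 1 by ring] at this
    exact_mod_cast this
  have h1 : ((a + d).factorial : ℂ) ≠ 0 := by exact_mod_cast Nat.factorial_ne_zero _
  have h2 : ((a + (a + d) + 1).factorial : ℂ) ≠ 0 := by exact_mod_cast Nat.factorial_ne_zero _
  have h3 : ((a + 1 + d).ascFactorial (a + 1) : ℂ) ≠ 0 := fun h => h2 (by rw [← hfac, h, mul_zero])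
  have hsign : ((-1 : ℂ)) ^ (a + (a + d) + 1) * (-1) ^ a = (-1) ^ (a + 1 + d) := by
    rw [← pow_add, show a + (a + d) + 1 + a = 2 * a + (a + 1 + d) by ring, pow_add, pow_mul]
    simp
  rw [(hasDerivAt_chooseQuotient a (a + d)).deriv, ← harmonicBetween_eq, ← hfac, neg_pow]
  push_cast
  rw [← hsign]
  field_simp

theorem sum_Icc_eq_sum_range_reflect {M c l : ℕ} (hl : l + c = M) (f : ℕ → ℂ) :
    ∑ k ∈ Finset.Icc l M, f k = ∑ j ∈ Finset.range (c + 1), f (M - j) := by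
  refine Finset.sum_nbij' (fun k => M - k) (fun j => M - j) ?_ ?_ ?_ ?_ ?_
  all_goals simp only [Finset.mem_Icc, Finset.mem_range]
  · intro k hk; omega
  · intro k hk; omega
  · intro k hk; omega
  · intro k hk; omega
  · intro k hk
    rw [Nat.sub_sub_self hk.2]

theorem proposition4 (n r d : ℕ) (s : ℝ) (hn : 1 ≤ n) (hr : 1 ≤ r) (hs : |s| < 1 / 3) :
    IsMeromorphicContinuation
        (fun k w => twoVarHurwitzTerm (xiPlus n s) (xiMinus n s) w (w - (d : ℂ)) k)
        (((d : ℝ) + 1) / 2)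
        (twoVarHurwitzDiag (xiPlus n s) (xiMinus n s) d) ∧
    AnalyticAt ℂ (twoVarHurwitzDiag (xiPlus n s) (xiMinus n s) d) (1 - (r : ℂ)) ∧
    detFactor n r d s =
      Complex.exp
          (((-1 : ℝ) ^ (r + d) * ((r - 1).factorial : ℝ) / (2 * ((r + d).ascFactorial r : ℝ))
            * harmonicBetween r (r + d - 1) * (2 * s) ^ (2 * r + d - 1) : ℝ) : ℂ)
        * (∏ k ∈ Finset.Icc r (2 * r + d - 1),
            milnorGamma k (xiPlus n s) ^
              (((-1 : ℝ) ^ (k + d) * ((r + d - 1).choose (k - r) : ℝ)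
                * (2 * s) ^ (2 * r + d - k - 1) : ℝ) : ℂ))
        * (∏ k ∈ Finset.Icc (r + d) (2 * r + d - 1),
            milnorGamma k (xiMinus n s) ^
              ((-((r - 1).choose (2 * r + d - k - 1) : ℝ)
                * (2 * s) ^ (2 * r + d - k - 1) : ℝ) : ℂ)) := by
  obtain ⟨a, rfl⟩ : ∃ a, r = a + 1 := ⟨r - 1, by omega⟩
  have hn' : (1 : ℝ) ≤ n := by exact_mod_cast hn
  obtain ⟨hs1, hs2⟩ := abs_lt.1 hs
  have hz : 0 < xiPlus n s := by unfold xiPlus; linarith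
  -- The lower bound -ξ⁺ < 2s amounts to 3s > -(n+1)/2; for n = 1 this is exactly s > -1/3.
  have hh : |2 * s| < xiPlus n s := by
    rw [abs_lt]
    unfold xiPlus
    constructor <;> linarith
  have hy : 0 < xiMinus n s := by unfold xiMinus; linarith
  have hxi : xiMinus n s = xiPlus n s - 2 * s := by unfold xiMinus xiPlus; ring
  have hpt : (1 : ℂ) - ((a + 1 : ℕ) : ℂ) = -(a : ℂ) := by push_cast; ring
  have hev := twoVarHurwitzDiag_eventuallyEq hz hh a d
  rw [← hxi] at hev
  have han : AnalyticAt ℂ (fun w => regularizedExpansion (xiPlus n s) (2 * s) a (a + d) 1 (w + a))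
      (-(a : ℂ)) :=
    (analyticAt_regularizedExpansion hz hh a (a + d) 1).comp_of_eq (by fun_prop) (by simp)
  refine ⟨?_, ?_, ?_⟩
  · rw [hxi]
    exact isMeromorphicContinuation_twoVarHurwitzDiag hz hh d
  · rw [hpt]
    exact han.congr hev.symm
  have hM : 2 * (a + 1) + d - 1 = a + (a + d) + 1 := by omega
  rw [detFactor, hpt, hev.deriv_eq, deriv_comp_add_const, neg_add_cancel,
    deriv_regularizedExpansion_one_eq hz hh, ← hxi, neg_pow_mul_deriv_chooseQuotient, hM,
    show a + 1 + d - 1 = a + d by omega, Nat.add_sub_cancel,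
    Finset.prod_congr rfl fun k hk => milnorGamma_cpow hz
      ((Nat.le_add_left 1 a).trans (Finset.mem_Icc.1 hk).1) _,
    Finset.prod_congr rfl fun k hk => milnorGamma_cpow hy
      ((Nat.le_add_left 1 (a + d)).trans
        ((by omega : a + d + 1 ≤ a + 1 + d).trans (Finset.mem_Icc.1 hk).1)) _,
    ← Complex.exp_sum, ← Complex.exp_sum, ← Complex.exp_add, ← Complex.exp_add,
    sum_Icc_eq_sum_range_reflect (c := a + d) (by ring),
    sum_Icc_eq_sum_range_reflect (c := a) (by ring), neg_sub, sub_eq_add_neg, neg_add,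
    ← Finset.sum_neg_distrib, ← Finset.sum_neg_distrib, ← add_assoc]
  have harg : ∀ j ≤ a + (a + d), (1 : ℂ) - ((a + (a + d) + 1 - j : ℕ) : ℂ) =
      j - ((a + (a + d) : ℕ) : ℂ) := fun j hj => by
    rw [Nat.cast_sub (by omega)]
    push_cast
    ring
  congr 1
  congr 1
  · congr 1
    refine Finset.sum_congr rfl fun j hj => ?_
    have hj' : j ≤ a + d := Nat.lt_succ_iff.1 (Finset.mem_range.1 hj)
    rw [harg j (by omega), show a + (a + d) + 1 - j - (a + 1) = a + d - j by omega,
      Nat.choose_symm hj',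
      show 2 * (a + 1) + d - (a + (a + d) + 1 - j) - 1 = j by omega]
    -- With k = 2a + d + 1 - j, the sign (-1)^(k+d) combines the (-1)^j of (-h)^j with the minus
    -- sign in the definition of I.
    have hsign : ((-1 : ℂ)) ^ (a + (a + d) + 1 - j + d) = -(-1) ^ j := by
      have h1 : ((-1 : ℂ)) ^ (a + (a + d) + 1 - j + d) * (-1) ^ j = -1 := by
        rw [← pow_add, show a + (a + d) + 1 - j + d + j = 2 * (a + d) + 1 by omega, pow_succ,
          pow_mul]
        simp
      have h2 : ((-1 : ℂ)) ^ j * (-1) ^ j = 1 := by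
        rw [← mul_pow]
        simp
      linear_combination (-1) ^ j * h1 - (-1) ^ (a + (a + d) + 1 - j + d) * h2
    push_cast
    rw [hsign, neg_pow]
    ring
  · refine Finset.sum_congr rfl fun j hj => ?_
    have hj' : j ≤ a := Nat.lt_succ_iff.1 (Finset.mem_range.1 hj)
    rw [harg j (by omega),
      show 2 * (a + 1) + d - (a + (a + d) + 1 - j) - 1 = j by omega]
    push_cast
    ring
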